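/- Let $\epsilon>0$. Write $c=e^{\epsilon}$, $t=e^{\epsilon/3}$, $\epsilon'=\ln\frac{3+\sqrt{65}}{2}$, and $$a=\begin{cases}0,&\epsilon<\ln 2,\\ -\frac16\Big(-c^2-4c-5+2\sqrt{\Delta_0}\cos\big(\tfrac{\pi}{3}+\tfrac13\arccos(-\tfrac{\Delta_1}{2\Delta_0^{3/2}})\big)\Big),&\ln 2\le\epsilon\le\epsilon',\\ \frac{c}{c+2},&\epsilon>\epsilon',\end{cases}$$ where $\Delta_0=c^4+14c^3+50c^2-2c+25$ and $\Delta_1=-2c^6-42c^5-270c^4-404c^3-918c^2+30c-250$. **Three-Outputs** maps $x\in[-1,1]$ to $Y\in\{-C,0,C\}$, $C=\frac{c+1}{(c-1)(1-a/c)}$. Its probabilities are $P_{0\leftarrow x}=a+(\frac{a}{c}-a)|x|$; for $0\le x\le 1$, $P_{C\leftarrow x}=\frac{1-a}{2}+\big(\frac{c-a}{c+1}-\frac{1-a}{2}\big)x$ and $P_{-C\leftarrow x}=\frac{1-a}{2}-\big(\frac{1-a}{2}-\frac{c-a}{c(c+1)}\big)x$; and, for $-1\le x<0$, $P_{C\leftarrow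 x}=P_{-C\leftarrow -x}$ and $P_{-C\leftarrow x}=P_{C\leftarrow -x}$. **PM-SUB** maps $x\in[-1,1]$ to $Y\in[-D,D]$, $D=\frac{(c+t)(t+1)}{t(c-1)}$: with $L=\frac{(c+t)(xt-1)}{t(c-1)}$ and $R=\frac{(c+t)(xt+1)}{t(c-1)}$, $Y$ is uniform on $[L,R]$ with probability $\frac{c}{t+c}$, and otherwise uniform on $[-D,L)\cup(R,D]$. **HM-TP** with mixing probability $\beta\in[0,1]$ invokes PM-SUB with probability $\beta$ and Three-Outputs with probability $1-\beta$. Let $\mathrm{Var}_{\mathcal P}[Y|x]$, $\mathrm{Var}_{\mathcal T}[Y|x]$ and $\mathrm{Var}_{\mathcal H}[Y|x]$ be the variances of the output of PM-SUB, Three-Outputs and HM-TP on input $x$. Let $\epsilon^*=3\ln r$, where $r$ is the root of $3x^5-2x^3+3x^2-5x-3$ near $1.22588$ (the only root within $10^{-5}$ of it), and put $$A=\frac{a^2c^2(c+1)^4}{4(c+t)^2(c-a)^4(c-1)}-\frac{a^2c^2(c+1)^4}{2(c+t)^2(c-1)(c-a)^4}+\frac{(t+1)^3+c-1}{3t^2(c-1)^2}-\frac{(1-a)c^2(c+1)^2}{(c+t)(c-1)^2(c-a)^2},$$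 $$B=-\frac{(1+t)^2a^2c^2(c+1)^4}{4(c+t)^2(c-a)^4(c-1)},$$ $$\beta_{\mathrm{opt}}=\begin{cases}0,&0<\epsilon<\epsilon^*,\\[2pt] \dfrac{2(c-a)^2(c-1)-ac(c+1)^2}{2(c-a)^2(c+t)-ac(c+1)^2},&\epsilon^*\le\epsilon<\ln 2,\\[6pt] \dfrac{-\sqrt{B/A}+c-1}{c+t},&\epsilon\ge\ln 2.\end{cases}$$ Then $|\epsilon^*-0.610986|<10^{-6}$, and for every $\epsilon>0$: for all $\beta\in[0,1]$ and $x\in[-1,1]$, $\mathrm{Var}_{\mathcal H}[Y|x]=\beta\,\mathrm{Var}_{\mathcal P}[Y|x]+(1-\beta)\,\mathrm{Var}_{\mathcal T}[Y|x]$; for every $\beta\in[0,1]$ the maximum $\max_{x\in[-1,1]}\mathrm{Var}_{\mathcal H}[Y|x]$ is attained; $\beta_{\mathrm{opt}}\in[0,1]$; and, as a function of $\beta\in[0,1]$, $\max_{x\in[-1,1]}\mathrm{Var}_{\mathcal H}[Y|x]$ is minimized at $\beta=\beta_{\mathrm{opt}}$. -/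

import Mathlib

open MeasureTheory ProbabilityTheory

noncomputable section

namespace HMTP

/-! ### Three-Outputs -/

def delta0 (ε : ℝ) : ℝ :=
  Real.exp ε ^ 4 + 14 * Real.exp ε ^ 3 + 50 * Real.exp ε ^ 2 - 2 * Real.exp ε + 25

def delta1 (ε : ℝ) : ℝ :=
  -2 * Real.exp ε ^ 6 - 42 * Real.exp ε ^ 5 - 270 * Real.exp ε ^ 4 - 404 * Real.exp ε ^ 3
    - 918 * Real.exp ε ^ 2 + 30 * Real.exp ε - 250

/-- The threshold `ε' = ln ((3 + √65) / 2) ≈ ln 5.53`. -/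
def epsPrime : ℝ := Real.log ((3 + √65) / 2)

/-- The probability `a = P_{0 ← 0}` with which Three-Outputs returns `0` on input `0`. -/
def a (ε : ℝ) : ℝ :=
  if ε < Real.log 2 then 0
  else if ε ≤ epsPrime then
    -(1 / 6) * (-Real.exp ε ^ 2 - 4 * Real.exp ε - 5
      + 2 * √(delta0 ε) * Real.cos (Real.pi / 3
          + 1 / 3 * Real.arccos (-(delta1 ε / (2 * delta0 ε ^ (3 / 2 : ℝ))))))
  else Real.exp ε / (Real.exp ε + 2)

/-- The nonzero output level `C` of Three-Outputs. -/
def outC (ε : ℝ) : ℝ :=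
  (Real.exp ε + 1) / ((Real.exp ε - 1) * (1 - a ε / Real.exp ε))

/-- `P_{C ← x}`. -/
def probPos (ε x : ℝ) : ℝ :=
  if 0 ≤ x then
    (1 - a ε) / 2 + ((Real.exp ε - a ε) / (Real.exp ε + 1) - (1 - a ε) / 2) * x
  else
    (1 - a ε) / 2
      + ((1 - a ε) / 2 - (Real.exp ε - a ε) / (Real.exp ε * (Real.exp ε + 1))) * x

/-- `P_{-C ← x}`. -/
def probNeg (ε x : ℝ) : ℝ :=
  if 0 ≤ x then
    (1 - a ε) / 2
      - ((1 - a ε) / 2 - (Real.exp ε - a ε) / (Real.exp ε * (Real.exp ε + 1))) * x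
  else
    (1 - a ε) / 2 - ((Real.exp ε - a ε) / (Real.exp ε + 1) - (1 - a ε) / 2) * x

/-- `P_{0 ← x}`. -/
def probZero (ε x : ℝ) : ℝ := a ε + (a ε / Real.exp ε - a ε) * |x|

/-- The output distribution of Three-Outputs on input `x`. -/
def threeOutputs (ε x : ℝ) : Measure ℝ :=
  ENNReal.ofReal (probNeg ε x) • Measure.dirac (-outC ε)
    + ENNReal.ofReal (probZero ε x) • Measure.dirac 0
    + ENNReal.ofReal (probPos ε x) • Measure.dirac (outC ε)

/-! ### The piecewise mechanism and PM-SUB -/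

/-- The bound of the output range `[-A, A]`. -/
def pmBound (ε t : ℝ) : ℝ := (Real.exp ε + t) * (t + 1) / (t * (Real.exp ε - 1))

def pmLeft (ε t x : ℝ) : ℝ := (Real.exp ε + t) * (x * t - 1) / (t * (Real.exp ε - 1))

def pmRight (ε t x : ℝ) : ℝ := (Real.exp ε + t) * (x * t + 1) / (t * (Real.exp ε - 1))

/-- The output distribution of the piecewise mechanism with parameter `t` on input `x`: with
probability `e^ε / (t + e^ε)` uniform on `[L, R]`, otherwise uniform on `[-A, L) ∪ (R, A]`. -/
def piecewiseMechanism (ε t x : ℝ) : Measure ℝ :=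
  ENNReal.ofReal (Real.exp ε / (t + Real.exp ε)) •
      ProbabilityTheory.cond volume (Set.Icc (pmLeft ε t x) (pmRight ε t x))
    + ENNReal.ofReal (1 - Real.exp ε / (t + Real.exp ε)) •
      ProbabilityTheory.cond volume (Set.Ico (-pmBound ε t) (pmLeft ε t x) ∪
        Set.Ioc (pmRight ε t x) (pmBound ε t))

/-- The output distribution of PM-SUB on input `x`. -/
def pmSub (ε x : ℝ) : Measure ℝ := piecewiseMechanism ε (Real.exp (ε / 3)) x

/-! ### The hybrid mechanism HM-TP -/

/-- The output distribution of HM-TP on input `x`: PM-SUB is invoked with probability `β`,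
otherwise Three-Outputs is. -/
def hmTP (ε β x : ℝ) : Measure ℝ :=
  ENNReal.ofReal β • pmSub ε x + ENNReal.ofReal (1 - β) • threeOutputs ε x

/-- The variance of the output of HM-TP on input `x`. -/
def hmVar (ε β x : ℝ) : ℝ := variance id (hmTP ε β x)

/-- The worst-case variance of HM-TP over the inputs `x ∈ [-1, 1]`. -/
def worstVar (ε β : ℝ) : ℝ := sSup (hmVar ε β '' Set.Icc (-1) 1)

/-! ### The mixing probability -/

/-- `3 x⁵ - 2 x³ + 3 x² - 5 x - 3` has exactly one root near `1.22588`. -/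
theorem existsUnique_root :
    ∃! x : ℝ, |x - 1.22588| < 1 / 10 ^ 5 ∧ 3 * x ^ 5 - 2 * x ^ 3 + 3 * x ^ 2 - 5 * x - 3 = 0 := by
  have hc : Continuous fun x : ℝ => 3 * x ^ 5 - 2 * x ^ 3 + 3 * x ^ 2 - 5 * x - 3 := by fun_prop
  have h := intermediate_value_Icc (a := (1.22588 : ℝ)) (b := 1.225885) (by norm_num)
    hc.continuousOn
  obtain ⟨x, hx, hx0⟩ := h (show (0 : ℝ) ∈ _ by constructor <;> norm_num)
  refine ⟨x, ⟨?_, hx0⟩, ?_⟩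
  · rw [abs_lt]
    constructor <;> linarith [hx.1, hx.2]
  · rintro y ⟨hy, hy0⟩
    rw [abs_lt] at hy
    have hy1 : 1 ≤ y := by linarith [hy.1]
    have hx1 : 1 ≤ x := by linarith [hx.1]
    have hfac : (y - x) * (3 * (y ^ 4 + y ^ 3 * x + y ^ 2 * x ^ 2 + y * x ^ 3 + x ^ 4)
        - 2 * (y ^ 2 + y * x + x ^ 2) + 3 * (y + x) - 5) = 0 := by
      simp only at hx0
      linear_combination hy0 - hx0
    rcases mul_eq_zero.1 hfac with h | h
    · linarith
    · exfalso
      have h1 : y ^ 2 ≤ y ^ 4 := pow_le_pow_right₀ hy1 (by norm_num)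
      have h2 : x ^ 2 ≤ x ^ 4 := pow_le_pow_right₀ hx1 (by norm_num)
      have hyx : 1 ≤ y * x := one_le_mul_of_one_le_of_one_le hy1 hx1
      have h3 : y * x ≤ y ^ 2 * x ^ 2 := by nlinarith
      have h4 : 0 ≤ y ^ 3 * x := by positivity
      have h5 : 0 ≤ y * x ^ 3 := by positivity
      nlinarith

/-- `ε* = 3 ln (the root of 3 x⁵ - 2 x³ + 3 x² - 5 x - 3 near 1.22588)`. -/
def epsStar : ℝ := 3 * Real.log existsUnique_root.choose

/-- The coefficient `A`, as a function of `c = e^ε`, `t = e^{ε/3}` and `a = P_{0 ← 0}`. -/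
def coefA (c t a : ℝ) : ℝ :=
  a ^ 2 * c ^ 2 * (c + 1) ^ 4 / (4 * (c + t) ^ 2 * (c - a) ^ 4 * (c - 1))
    - a ^ 2 * c ^ 2 * (c + 1) ^ 4 / (2 * (c + t) ^ 2 * (c - 1) * (c - a) ^ 4)
    + ((t + 1) ^ 3 + c - 1) / (3 * t ^ 2 * (c - 1) ^ 2)
    - (1 - a) * c ^ 2 * (c + 1) ^ 2 / ((c + t) * (c - 1) ^ 2 * (c - a) ^ 2)

/-- The coefficient `B`, as a function of `c = e^ε`, `t = e^{ε/3}` and `a = P_{0 ← 0}`. -/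
def coefB (c t a : ℝ) : ℝ :=
  -((1 + t) ^ 2 * a ^ 2 * c ^ 2 * (c + 1) ^ 4 / (4 * (c + t) ^ 2 * (c - a) ^ 4 * (c - 1)))

/-- The value of `β` for `ε* ≤ ε < ln 2`, as a function of `c`, `t` and `a`. -/
def beta1 (c t a : ℝ) : ℝ :=
  (2 * (c - a) ^ 2 * (c - 1) - a * c * (c + 1) ^ 2)
    / (2 * (c - a) ^ 2 * (c + t) - a * c * (c + 1) ^ 2)

/-- The value of `β` for `ε ≥ ln 2`, as a function of `c`, `t` and `a`. -/
def beta3 (c t a : ℝ) : ℝ :=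
  (-√(coefB c t a / coefA c t a) + c - 1) / (c + t)

/-- The optimal mixing probability. -/
def betaOpt (ε : ℝ) : ℝ :=
  if ε < epsStar then 0
  else if ε < Real.log 2 then beta1 (Real.exp ε) (Real.exp (ε / 3)) (a ε)
  else beta3 (Real.exp ε) (Real.exp (ε / 3)) (a ε)

end HMTP

end

/-! Write `c = e^ε`, `t = e^(ε/3)`. Both mechanisms are unbiased, so the variance of the mixture is
the mixture of the variances. Computing moments gives `Var_P = (1+t)/(c-1) x² + m` and `Var_T = v +
w|x| - x²`, where `m`, `v`, `w` are `pmVarZero`, `toVarZero`, `slope`. Hence `H(β, x) = Var_H` is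
affine in `β`, with `β`-coefficient `q(|x|)`, `q(x) = Var_P - Var_T = K x² - w x + n`, `K =
(c+t)/(c-1)`, `n = m - v`.

Optimality comes from a saddle point (`isMinOn_worstVar`). At a root `z` of `q` the value `H(β, z)`
does not depend on `β`, so it suffices to choose `β` for which `z` maximizes `H(β, ·)`. Solving for
this `β` with `z` the larger root gives the stated formula (`exists_saddle`, `coefB_div_coefA`). It
works as soon as `w ≤ 2`, `q(1) ≥ 0` and `q(w/2) ≤ 0`, which put `z` in `[w/2, 1]` and `β` in `[0,
1]`.

For `ε < ln 2` one has `a = 0` and `w = 0`, and the sign of `n` is opposite to that of the quintic: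
below `ε*` the saddle is `(0, 0)`, above it the conditions hold. For larger `ε` the conditions
become polynomial inequalities: in the trigonometric range `a` is known only as the root in `[0, 1]`
of a cubic (`a_middle`), and rational bounds on it suffice (`middle_conditions`); beyond it `a =
c/(c+2)` is explicit (`large_conditions`). -/

namespace HMTP

/-! ### Moments of finite measures on the line -/

/-- `μ` is a finite measure on `ℝ` with finite second moment, total mass `m₀`, first moment `m₁`
and second moment `m₂`. -/
structure HasMoments (μ : Measure ℝ) (m₀ m₁ m₂ : ℝ) : Prop where
  finite : IsFiniteMeasure μ
  integrable_id : Integrable (fun x : ℝ => x) μ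
  integrable_sq : Integrable (fun x : ℝ => x ^ 2) μ
  mass : μ.real Set.univ = m₀
  first : ∫ x, x ∂μ = m₁
  second : ∫ x, x ^ 2 ∂μ = m₂

theorem HasMoments.add {μ ν : Measure ℝ} {m₀ m₁ m₂ n₀ n₁ n₂ : ℝ} (h : HasMoments μ m₀ m₁ m₂)
    (k : HasMoments ν n₀ n₁ n₂) : HasMoments (μ + ν) (m₀ + n₀) (m₁ + n₁) (m₂ + n₂) := by
  have := h.finite
  have := k.finite
  refine ⟨inferInstance, h.integrable_id.add_measure k.integrable_id,
    h.integrable_sq.add_measure k.integrable_sq, ?_, ?_, ?_⟩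
  · rw [measureReal_add_apply, h.mass, k.mass]
  · rw [integral_add_measure h.integrable_id k.integrable_id, h.first, k.first]
  · rw [integral_add_measure h.integrable_sq k.integrable_sq, h.second, k.second]

theorem HasMoments.smul {μ : Measure ℝ} {m₀ m₁ m₂ : ℝ} (h : HasMoments μ m₀ m₁ m₂) {w : ℝ}
    (hw : 0 ≤ w) : HasMoments (ENNReal.ofReal w • μ) (w * m₀) (w * m₁) (w * m₂) := by
  have := h.finite
  refine ⟨Measure.smul_finite μ ENNReal.ofReal_ne_top,
    h.integrable_id.smul_measure ENNReal.ofReal_ne_top,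
    h.integrable_sq.smul_measure ENNReal.ofReal_ne_top, ?_, ?_, ?_⟩
  · rw [measureReal_ennreal_smul_apply, h.mass, ENNReal.toReal_ofReal hw]
  · rw [integral_smul_measure, h.first, ENNReal.toReal_ofReal hw, smul_eq_mul]
  · rw [integral_smul_measure, h.second, ENNReal.toReal_ofReal hw, smul_eq_mul]

theorem hasMoments_dirac (y : ℝ) : HasMoments (Measure.dirac y) 1 y (y ^ 2) := by
  refine ⟨inferInstance, integrable_dirac (by simp [enorm_lt_top]),
    integrable_dirac (by simp [enorm_lt_top]), by simp, ?_, ?_⟩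
  · rw [integral_dirac]
  · rw [integral_dirac]

theorem hasMoments_restrict_Ioc {l u : ℝ} (h : l ≤ u) :
    HasMoments (volume.restrict (Set.Ioc l u)) (u - l) ((u ^ 2 - l ^ 2) / 2)
      ((u ^ 3 - l ^ 3) / 3) := by
  have hi : ∀ n : ℕ, IntegrableOn (fun x : ℝ => x ^ n) (Set.Ioc l u) := fun n =>
    ((continuous_pow n).integrableOn_Icc).mono_set Set.Ioc_subset_Icc_self
  refine ⟨⟨by simp⟩, by simpa [IntegrableOn] using hi 1, hi 2, ?_, ?_, ?_⟩
  · simp [measureReal_def, h]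
  · rw [← intervalIntegral.integral_of_le h, integral_id]
  · rw [← intervalIntegral.integral_of_le h, integral_pow]
    norm_num

theorem HasMoments.cond {s : Set ℝ} {m₀ m₁ m₂ : ℝ} (h : HasMoments (volume.restrict s) m₀ m₁ m₂)
    (h₀ : 0 < m₀) : HasMoments (ProbabilityTheory.cond volume s) 1 (m₁ / m₀) (m₂ / m₀) := by
  have hs : (volume s)⁻¹ = ENNReal.ofReal m₀⁻¹ := by
    have hm := h.mass
    have := h.finite
    have hf : volume s ≠ ⊤ := by
      simpa using (measure_lt_top (volume.restrict s) Set.univ).ne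
    rw [measureReal_def, Measure.restrict_apply_univ] at hm
    rw [ENNReal.ofReal_inv_of_pos h₀, ← hm, ENNReal.ofReal_toReal hf]
  have := h.smul (inv_nonneg.2 h₀.le)
  rw [← hs, inv_mul_cancel₀ h₀.ne', inv_mul_eq_div, inv_mul_eq_div] at this
  exact this

theorem HasMoments.variance_eq {μ : Measure ℝ} {m₁ m₂ : ℝ} (h : HasMoments μ 1 m₁ m₂) :
    variance id μ = m₂ - m₁ ^ 2 := by
  have := h.finite
  have hp : IsProbabilityMeasure μ := by
    constructor
    have hm := h.mass
    rw [measureReal_def] at hm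
    rw [← ENNReal.ofReal_toReal (measure_ne_top μ Set.univ), hm, ENNReal.ofReal_one]
  have hL : MemLp (id : ℝ → ℝ) 2 μ :=
    (memLp_two_iff_integrable_sq measurable_id.aestronglyMeasurable).2 h.integrable_sq
  rw [variance_eq_sub hL]
  have e1 : ∫ x, (id : ℝ → ℝ) x ∂μ = m₁ := h.first
  have e2 : ∫ x, ((id : ℝ → ℝ) ^ 2) x ∂μ = m₂ := h.second
  rw [e1, e2]

theorem hasMoments_restrict_Icc {l u : ℝ} (h : l ≤ u) :
    HasMoments (volume.restrict (Set.Icc l u)) (u - l) ((u ^ 2 - l ^ 2) / 2)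
      ((u ^ 3 - l ^ 3) / 3) := by
  rw [← Measure.restrict_congr_set (Ioc_ae_eq_Icc (a := l) (b := u))]
  exact hasMoments_restrict_Ioc h

theorem hasMoments_restrict_Ico {l u : ℝ} (h : l ≤ u) :
    HasMoments (volume.restrict (Set.Ico l u)) (u - l) ((u ^ 2 - l ^ 2) / 2)
      ((u ^ 3 - l ^ 3) / 3) := by
  rw [Measure.restrict_congr_set (Ico_ae_eq_Ioc (a := l) (b := u))]
  exact hasMoments_restrict_Ioc h

theorem hasMoments_restrict_Ico_union_Ioc {p l r q : ℝ} (h₁ : p ≤ l) (h₂ : l ≤ r) (h₃ : r ≤ q) :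
    HasMoments (volume.restrict (Set.Ico p l ∪ Set.Ioc r q)) (l - p + (q - r))
      ((l ^ 2 - p ^ 2) / 2 + (q ^ 2 - r ^ 2) / 2) ((l ^ 3 - p ^ 3) / 3 + (q ^ 3 - r ^ 3) / 3) := by
  rw [Measure.restrict_union _ measurableSet_Ioc]
  · exact (hasMoments_restrict_Ico h₁).add (hasMoments_restrict_Ioc h₃)
  · rw [Set.disjoint_left]
    intro y hy hy'
    linarith [hy.2, hy'.1]

/-! ### Moments and variances of the mechanisms -/

/-- The variance of the piecewise mechanism at `0`, as a function of `c = e^ε` and `t`. -/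
noncomputable def pmVarZero (c t : ℝ) : ℝ :=
  (c + t) * ((t + 1) ^ 3 + c - 1) / (3 * t ^ 2 * (c - 1) ^ 2)

theorem hasMoments_piecewiseMechanism {ε t x : ℝ} (hε : 0 < ε) (ht : 0 < t)
    (hx : x ∈ Set.Icc (-1 : ℝ) 1) :
    HasMoments (piecewiseMechanism ε t x) 1 x
      ((1 + t) / (Real.exp ε - 1) * x ^ 2 + pmVarZero (Real.exp ε) t + x ^ 2) := by
  have hc : 1 < Real.exp ε := Real.one_lt_exp_iff.2 hε
  unfold piecewiseMechanism
  simp only [pmLeft, pmRight, pmBound, pmVarZero]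
  set c := Real.exp ε with hcdef
  have hc0 : 0 < c - 1 := by linarith
  have hct : 0 < c + t := by linarith
  obtain ⟨hx1, hx2⟩ := hx
  have hd : 0 < t * (c - 1) := mul_pos ht hc0
  -- `e1`, `e2`, `e3` are the lengths of the left outer, central and right outer pieces. An outer
  -- piece may be empty when `x = ±1`, but by `e4` their total length is positive and independent of
  -- `x`.
  have e1 : (c + t) * (x * t - 1) / (t * (c - 1)) - -((c + t) * (t + 1) / (t * (c - 1)))
      = (c + t) * (1 + x) / (c - 1) := by field_simp; ring
  have e2 : (c + t) * (x * t + 1) / (t * (c - 1)) - (c + t) * (x * t - 1) / (t * (c - 1))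
      = 2 * (c + t) / (t * (c - 1)) := by field_simp; ring
  have e3 : (c + t) * (t + 1) / (t * (c - 1)) - (c + t) * (x * t + 1) / (t * (c - 1))
      = (c + t) * (1 - x) / (c - 1) := by field_simp; ring
  have p1 : 0 ≤ (c + t) * (1 + x) / (c - 1) := by
    have : 0 ≤ 1 + x := by linarith
    positivity
  have p2 : 0 < 2 * (c + t) / (t * (c - 1)) := by positivity
  have p3 : 0 ≤ (c + t) * (1 - x) / (c - 1) := by
    have : 0 ≤ 1 - x := by linarith
    positivity
  have h1 := (hasMoments_restrict_Icc (l := (c + t) * (x * t - 1) / (t * (c - 1)))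
    (u := (c + t) * (x * t + 1) / (t * (c - 1))) (by linarith)).cond (by linarith)
  have e4 : (c + t) * (1 + x) / (c - 1) + (c + t) * (1 - x) / (c - 1) = 2 * (c + t) / (c - 1) := by
    field_simp; ring
  have p4 : 0 < 2 * (c + t) / (c - 1) := by positivity
  have h2 := (hasMoments_restrict_Ico_union_Ioc (p := -((c + t) * (t + 1) / (t * (c - 1))))
    (l := (c + t) * (x * t - 1) / (t * (c - 1))) (r := (c + t) * (x * t + 1) / (t * (c - 1)))
    (q := (c + t) * (t + 1) / (t * (c - 1)))
    (by linarith) (by linarith) (by linarith)).cond (by rw [e1, e3, e4]; exact p4)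
  rw [e2] at h1
  rw [e1, e3, e4] at h2
  have hw : 1 - c / (t + c) = t / (t + c) := by field_simp; ring
  have h := (h1.smul (w := c / (t + c)) (by positivity)).add
    (h2.smul (w := t / (t + c)) (by positivity))
  rw [hw]
  have hc1 : c - 1 ≠ 0 := hc0.ne'
  convert h using 1
  · field_simp; ring
  · field_simp; ring
  · field_simp; ring

/-- The coefficient of `|x|` in the variance of Three-Outputs, as a function of `c = e^ε` and of
`a = P_{0 ← 0}`. -/
noncomputable def slope (c a : ℝ) : ℝ := a * c * (c + 1) ^ 2 / ((c - 1) * (c - a) ^ 2)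

/-- The variance of Three-Outputs at `0`, as a function of `c = e^ε` and of `a = P_{0 ← 0}`. -/
noncomputable def toVarZero (c a : ℝ) : ℝ :=
  c ^ 2 * (c + 1) ^ 2 * (1 - a) / ((c - 1) ^ 2 * (c - a) ^ 2)

theorem hasMoments_threeOutputs {ε x : ℝ} (hε : 0 < ε) (ha0 : 0 ≤ a ε) (ha1 : a ε ≤ 1)
    (hx : x ∈ Set.Icc (-1 : ℝ) 1) :
    HasMoments (threeOutputs ε x) 1 x
      (toVarZero (Real.exp ε) (a ε) + slope (Real.exp ε) (a ε) * |x|) := by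
  have hc : 1 < Real.exp ε := Real.one_lt_exp_iff.2 hε
  unfold threeOutputs
  simp only [probNeg, probPos, probZero, outC, slope, toVarZero]
  generalize Real.exp ε = c at *
  generalize a ε = a at *
  obtain ⟨hx1, hx2⟩ := hx
  have hca : 0 < c - a := by linarith
  have hc1 : 0 < c - 1 := by linarith
  have hc0 : 0 < c := by linarith
  have hC : (c + 1) / ((c - 1) * (1 - a / c)) = c * (c + 1) / ((c - 1) * (c - a)) := by
    field_simp
  rw [hC]
  -- The output probabilities interpolate affinely between their values at `0` and at `±1`, so
  -- nonnegativity of those values suffices.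
  have q1 : 0 ≤ (1 - a) / 2 := by linarith
  have q2 : 0 ≤ (c - a) / (c + 1) := by positivity
  have q3 : 0 ≤ (c - a) / (c * (c + 1)) := by positivity
  have key : ∀ p q z y : ℝ, 0 ≤ p → 0 ≤ q → 0 ≤ z → p + z + q = 1 →
      (q - p) * y = x → (p + q) * y ^ 2 = c ^ 2 * (c + 1) ^ 2 * (1 - a) / ((c - 1) ^ 2 * (c - a) ^ 2)
        + a * c * (c + 1) ^ 2 / ((c - 1) * (c - a) ^ 2) * |x| →
      HasMoments (ENNReal.ofReal p • Measure.dirac (-y) + ENNReal.ofReal z • Measure.dirac 0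
        + ENNReal.ofReal q • Measure.dirac y) 1 x
        (c ^ 2 * (c + 1) ^ 2 * (1 - a) / ((c - 1) ^ 2 * (c - a) ^ 2)
        + a * c * (c + 1) ^ 2 / ((c - 1) * (c - a) ^ 2) * |x|) := by
    intro p q z y hp hq hz h1 h2 h3
    convert (((hasMoments_dirac (-y)).smul hp).add ((hasMoments_dirac 0).smul hz)).add
      ((hasMoments_dirac y).smul hq) using 1
    · linarith
    · linarith
    · linarith
  have hac : a / c ≤ 1 := by rw [div_le_one hc0]; linarith
  have hca0 : c - a ≠ 0 := hca.ne'
  have hc10 : c - 1 ≠ 0 := hc1.ne'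
  split_ifs with hx0
  · rw [abs_of_nonneg hx0] at *
    have hx3 : 0 ≤ 1 - x := by linarith
    apply key
    · have := add_nonneg (mul_nonneg q1 hx3) (mul_nonneg q3 hx0)
      linarith
    · have := add_nonneg (mul_nonneg q1 hx3) (mul_nonneg q2 hx0)
      linarith
    · have := add_nonneg (mul_nonneg ha0 hx3) (mul_nonneg (div_nonneg ha0 hc0.le) hx0)
      linarith
    · field_simp; ring
    · field_simp; ring
    · field_simp; ring
  · push Not at hx0
    rw [abs_of_neg hx0] at *
    have hx3 : 0 ≤ 1 + x := by linarith
    have hx4 : 0 ≤ -x := by linarith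
    apply key
    · have := add_nonneg (mul_nonneg q1 hx3) (mul_nonneg q2 hx4)
      linarith
    · have := add_nonneg (mul_nonneg q1 hx3) (mul_nonneg q3 hx4)
      linarith
    · have := add_nonneg (mul_nonneg ha0 hx3) (mul_nonneg (div_nonneg ha0 hc0.le) hx4)
      linarith
    · field_simp; ring
    · field_simp; ring
    · field_simp; ring

theorem variance_pmSub {ε x : ℝ} (hε : 0 < ε) (hx : x ∈ Set.Icc (-1 : ℝ) 1) :
    variance id (pmSub ε x) = (1 + Real.exp (ε / 3)) / (Real.exp ε - 1) * x ^ 2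
      + pmVarZero (Real.exp ε) (Real.exp (ε / 3)) := by
  rw [pmSub, (hasMoments_piecewiseMechanism hε (Real.exp_pos _) hx).variance_eq]
  ring

theorem variance_threeOutputs {ε x : ℝ} (hε : 0 < ε) (ha0 : 0 ≤ a ε) (ha1 : a ε ≤ 1)
    (hx : x ∈ Set.Icc (-1 : ℝ) 1) :
    variance id (threeOutputs ε x) =
      toVarZero (Real.exp ε) (a ε) + slope (Real.exp ε) (a ε) * |x| - x ^ 2 :=
  (hasMoments_threeOutputs hε ha0 ha1 hx).variance_eq

theorem hmVar_eq {ε β x : ℝ} (hε : 0 < ε) (ha0 : 0 ≤ a ε) (ha1 : a ε ≤ 1)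
    (hβ : β ∈ Set.Icc (0 : ℝ) 1) (hx : x ∈ Set.Icc (-1 : ℝ) 1) :
    hmVar ε β x = β * variance id (pmSub ε x) + (1 - β) * variance id (threeOutputs ε x) := by
  have hP := hasMoments_piecewiseMechanism hε (Real.exp_pos (ε / 3)) hx
  have hT := hasMoments_threeOutputs hε ha0 ha1 hx
  have h := (hP.smul hβ.1).add (hT.smul (sub_nonneg.2 hβ.2))
  rw [mul_one, mul_one, add_sub_cancel] at h
  rw [variance_pmSub hε hx, variance_threeOutputs hε ha0 ha1 hx]
  refine h.variance_eq.trans ?_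
  ring

/-! ### Saddle points of the mixed variance -/

/-- If the quadratic `K x² - w x + n`, the difference of two variances, has its larger root `z` in
`[w / 2, 1]`, then for the mixing probability determined by `u` the mixture is maximal at `z`. -/
theorem exists_saddle {c t w n u : ℝ} (hc : 1 < c) (ht : 0 < t) (hw0 : 0 ≤ w) (hw : w ≤ 2)
    (h1 : 0 ≤ (c + t) / (c - 1) - w + n)
    (hs : (c + t) / (c - 1) * w ^ 2 / 4 - w ^ 2 / 2 + n ≤ 0) (hu0 : 0 ≤ u)
    (hu : u * √(w ^ 2 - 4 * ((c + t) / (c - 1)) * n) = (1 + t) * w) (hwu : w = 0 → u = 0) :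
    (c - 1 - u) / (c + t) ∈ Set.Icc (0 : ℝ) 1 ∧ ∃ z ∈ Set.Icc (0 : ℝ) 1,
      (c + t) / (c - 1) * z ^ 2 - w * z + n = 0 ∧ ∀ y : ℝ,
        ((c - 1 - u) / (c + t) * ((c + t) / (c - 1)) - 1) * y ^ 2
            + (1 - (c - 1 - u) / (c + t)) * w * y
          ≤ ((c - 1 - u) / (c + t) * ((c + t) / (c - 1)) - 1) * z ^ 2
            + (1 - (c - 1 - u) / (c + t)) * w * z := by
  have hc1 : 0 < c - 1 := by linarith
  have hct : 0 < c + t := by linarith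
  obtain ⟨K, hK⟩ : ∃ K, K = (c + t) / (c - 1) := ⟨_, rfl⟩
  have hKc : K * (c - 1) = c + t := by rw [hK]; field_simp
  have hK1 : 1 < K := by rw [hK, lt_div_iff₀ hc1]; linarith
  rw [← hK] at h1 hs hu ⊢
  obtain ⟨D, hD⟩ : ∃ D, D = √(w ^ 2 - 4 * K * n) := ⟨_, rfl⟩
  rw [← hD] at hu
  -- This is `hs` multiplied by `4 * K`. It says that the larger root is at least `w / 2`, and it is
  -- also what makes the mixing probability nonnegative.
  have hDn : (w * (K - 1)) ^ 2 ≤ w ^ 2 - 4 * K * n := by nlinarith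
  have hwD : w * (K - 1) ≤ D := hD ▸ Real.le_sqrt_of_sq_le hDn
  have hD2 : D ^ 2 = w ^ 2 - 4 * K * n := hD ▸ Real.sq_sqrt ((sq_nonneg _).trans hDn)
  have hD0 : 0 ≤ D := hD ▸ Real.sqrt_nonneg _
  have huc : u ≤ c - 1 := by
    rcases hw0.eq_or_lt with h | h
    · rw [hwu h.symm]; exact hc1.le
    · have hK1w : 0 < w * (K - 1) := mul_pos h (by linarith)
      have : u * (w * (K - 1)) ≤ (c - 1) * (w * (K - 1)) := by
        calc u * (w * (K - 1)) ≤ u * D := mul_le_mul_of_nonneg_left hwD hu0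
          _ = (c - 1) * (w * (K - 1)) := by rw [hu]; linear_combination (-w) * hKc
      exact le_of_mul_le_mul_right this hK1w
  -- After squaring, this is `h1` multiplied by `4 * K`; it places the larger root at most at `1`.
  have hDK : D ≤ 2 * K - w := by
    refine abs_le_of_sq_le_sq' ?_ (by linarith) |>.2
    nlinarith
  refine ⟨⟨div_nonneg (by linarith) hct.le, (div_le_one hct).2 (by linarith)⟩,
    (w + D) / (2 * K), ⟨by positivity, (div_le_one (by linarith)).2 (by linarith)⟩, ?_, ?_⟩
  · have hK0 : K ≠ 0 := by linarith
    field_simp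
    linear_combination hD2
  · intro y
    have hK0 : K ≠ 0 := by linarith
    -- By `e1` and `e2` the mixture is, up to a constant, `-(u / (c - 1)) * (y - z) ^ 2`, with `z`
    -- the larger root.
    have e1 : (c - 1 - u) / (c + t) * K - 1 = -(u / (c - 1)) := by
      rw [hK]; field_simp; ring
    have e2 : (1 - (c - 1 - u) / (c + t)) * w = u / (c - 1) * (2 * ((w + D) / (2 * K))) := by
      rw [hK]; field_simp; linear_combination (-1) * hu
    rw [e1, e2]
    have : 0 ≤ u / (c - 1) * (y - (w + D) / (2 * K)) ^ 2 := by positivity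
    linarith

/-- Both coefficients carry the factor `-(c - 1) / (4 * (c + t) ^ 2)`. What remains of `coefA` is
the discriminant of `Var_P - Var_T`, so `√(B / A)` is the `u` of `exists_saddle`. -/
theorem coefB_div_coefA {c t a : ℝ} (hc : 1 < c) (ht : 0 < t) (hca : a < c) :
    coefB c t a / coefA c t a = ((1 + t) * slope c a) ^ 2 /
      (slope c a ^ 2 - 4 * ((c + t) / (c - 1)) * (pmVarZero c t - toVarZero c a)) := by
  have hc1 : c - 1 ≠ 0 := by linarith
  have hct : c + t ≠ 0 := by linarith
  have hca' : c - a ≠ 0 := by linarith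
  have hA : coefA c t a = -((c - 1) / (4 * (c + t) ^ 2)) *
      (slope c a ^ 2 - 4 * ((c + t) / (c - 1)) * (pmVarZero c t - toVarZero c a)) := by
    unfold coefA slope pmVarZero toVarZero
    field_simp
    ring
  have hB : coefB c t a = -((c - 1) / (4 * (c + t) ^ 2)) * ((1 + t) * slope c a) ^ 2 := by
    unfold coefB slope
    field_simp
  rw [hA, hB, mul_div_mul_left]
  have : 0 < c - 1 := by linarith
  have : 0 < (c - 1) / (4 * (c + t) ^ 2) := by positivity
  linarith

theorem isGreatest_worstVar {ε β : ℝ} (hε : 0 < ε) (ha0 : 0 ≤ a ε) (ha1 : a ε ≤ 1)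
    (hβ : β ∈ Set.Icc (0 : ℝ) 1) :
    IsGreatest (hmVar ε β '' Set.Icc (-1) 1) (worstVar ε β) := by
  have hcont : ContinuousOn (hmVar ε β) (Set.Icc (-1) 1) := by
    refine ContinuousOn.congr (f := fun x : ℝ =>
      β * ((1 + Real.exp (ε / 3)) / (Real.exp ε - 1) * x ^ 2
        + pmVarZero (Real.exp ε) (Real.exp (ε / 3)))
      + (1 - β) * (toVarZero (Real.exp ε) (a ε) + slope (Real.exp ε) (a ε) * |x| - x ^ 2)) ?_ ?_
    · fun_prop
    · intro x hx
      rw [hmVar_eq hε ha0 ha1 hβ hx, variance_pmSub hε hx, variance_threeOutputs hε ha0 ha1 hx]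
  exact (isCompact_Icc.image_of_continuousOn hcont).isGreatest_sSup
    ((Set.nonempty_Icc.2 (by norm_num)).image _)

/-- A saddle point of the variance yields an optimal mixing probability. -/
theorem isMinOn_worstVar {ε b z : ℝ} (hε : 0 < ε) (ha0 : 0 ≤ a ε) (ha1 : a ε ≤ 1)
    (hb : b ∈ Set.Icc (0 : ℝ) 1) (hz : z ∈ Set.Icc (-1 : ℝ) 1)
    (hmax : ∀ x ∈ Set.Icc (-1 : ℝ) 1, hmVar ε b x ≤ hmVar ε b z)
    (hmin : ∀ β ∈ Set.Icc (0 : ℝ) 1, hmVar ε b z ≤ hmVar ε β z) :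
    IsMinOn (worstVar ε) (Set.Icc 0 1) b := by
  intro β hβ
  obtain ⟨x, hx, hxe⟩ := (isGreatest_worstVar hε ha0 ha1 hb).1
  calc worstVar ε b = hmVar ε b x := hxe.symm
    _ ≤ hmVar ε b z := hmax x hx
    _ ≤ hmVar ε β z := hmin β hβ
    _ ≤ worstVar ε β := (isGreatest_worstVar hε ha0 ha1 hβ).2 (Set.mem_image_of_mem _ hz)

/-- In this form the variance is quadratic in `|x|` and affine in `β`, and the coefficient of `β` is
`Var_P - Var_T`. -/
theorem hmVar_formula {ε β x : ℝ} (hε : 0 < ε) (ha0 : 0 ≤ a ε) (ha1 : a ε ≤ 1)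
    (hβ : β ∈ Set.Icc (0 : ℝ) 1) (hx : x ∈ Set.Icc (-1 : ℝ) 1) :
    hmVar ε β x = (β * ((Real.exp ε + Real.exp (ε / 3)) / (Real.exp ε - 1)) - 1) * |x| ^ 2
      + (1 - β) * slope (Real.exp ε) (a ε) * |x|
      + β * (pmVarZero (Real.exp ε) (Real.exp (ε / 3)) - toVarZero (Real.exp ε) (a ε))
      + toVarZero (Real.exp ε) (a ε) := by
  have hc : Real.exp ε - 1 ≠ 0 := by
    have := Real.one_lt_exp_iff.2 hε
    linarith
  rw [hmVar_eq hε ha0 ha1 hβ hx, variance_pmSub hε hx, variance_threeOutputs hε ha0 ha1 hx, sq_abs]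
  field_simp
  ring

/-- The hypotheses `h1` and `hs` are the signs of `Var_P - Var_T` at `1` and at half the slope,
where Three-Outputs has its largest variance. -/
theorem isMinOn_worstVar_of_root {ε u : ℝ} (hε : 0 < ε) (ha0 : 0 ≤ a ε) (ha1 : a ε ≤ 1)
    (hw : slope (Real.exp ε) (a ε) ≤ 2)
    (h1 : 0 ≤ (Real.exp ε + Real.exp (ε / 3)) / (Real.exp ε - 1) - slope (Real.exp ε) (a ε)
      + (pmVarZero (Real.exp ε) (Real.exp (ε / 3)) - toVarZero (Real.exp ε) (a ε)))
    (hs : (Real.exp ε + Real.exp (ε / 3)) / (Real.exp ε - 1) * slope (Real.exp ε) (a ε) ^ 2 / 4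
      - slope (Real.exp ε) (a ε) ^ 2 / 2
      + (pmVarZero (Real.exp ε) (Real.exp (ε / 3)) - toVarZero (Real.exp ε) (a ε)) ≤ 0)
    (hu : u = √(coefB (Real.exp ε) (Real.exp (ε / 3)) (a ε)
      / coefA (Real.exp ε) (Real.exp (ε / 3)) (a ε))) :
    (Real.exp ε - 1 - u) / (Real.exp ε + Real.exp (ε / 3)) ∈ Set.Icc (0 : ℝ) 1 ∧
      IsMinOn (worstVar ε) (Set.Icc 0 1)
        ((Real.exp ε - 1 - u) / (Real.exp ε + Real.exp (ε / 3))) := by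
  have hc : 1 < Real.exp ε := Real.one_lt_exp_iff.2 hε
  have ht : 0 < Real.exp (ε / 3) := Real.exp_pos _
  have hform := fun β x => hmVar_formula (β := β) (x := x) hε ha0 ha1
  rw [coefB_div_coefA hc ht (by linarith)] at hu
  have hmin := fun b z => isMinOn_worstVar (b := b) (z := z) hε ha0 ha1
  have hw0 : 0 ≤ slope (Real.exp ε) (a ε) := by
    unfold slope
    have : 0 < Real.exp ε - 1 := by linarith
    positivity
  generalize Real.exp ε = c at *
  generalize Real.exp (ε / 3) = t at *
  generalize slope c (a ε) = w at *
  generalize toVarZero c (a ε) = v at *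
  generalize pmVarZero c t = m at *
  have hc1 : 0 < c - 1 := by linarith
  have hK1 : 1 < (c + t) / (c - 1) := by rw [lt_div_iff₀ hc1]; linarith
  have hsad := exists_saddle (u := u) hc ht hw0 hw h1 hs (hu ▸ Real.sqrt_nonneg _) ?_ ?_
  · obtain ⟨hβ, z, hz, hroot, hmax⟩ := hsad
    refine ⟨hβ, hmin _ z hβ ⟨by linarith [hz.1], hz.2⟩ ?_ ?_⟩
    · intro x hx
      rw [hform _ x hβ hx, hform _ z hβ ⟨by linarith [hz.1], hz.2⟩, abs_of_nonneg hz.1]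
      linarith [hmax |x|]
    · intro β hβ'
      have hz' : z ∈ Set.Icc (-1 : ℝ) 1 := ⟨by linarith [hz.1], hz.2⟩
      rw [hform _ z hβ hz', hform _ z hβ' hz', abs_of_nonneg hz.1]
      refine le_of_eq ?_
      linear_combination ((c - 1 - u) / (c + t) - β) * hroot
  · rcases hw0.eq_or_lt with h | h
    · rw [hu, ← h]; simp
    · have hD : 0 < w ^ 2 - 4 * ((c + t) / (c - 1)) * (m - v) := by
        have : 0 < (w * ((c + t) / (c - 1) - 1)) ^ 2 := by
          have := mul_pos h (sub_pos.2 hK1)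
          positivity
        nlinarith
      rw [hu, Real.sqrt_div' _ hD.le, Real.sqrt_sq (by positivity),
        div_mul_cancel₀ _ (Real.sqrt_pos.2 hD).ne']
  · intro h
    rw [hu, h]; simp

/-! ### The cubic equation for `a` and its trigonometric root -/

/-- The cubic in `a` whose root in `[0, 1]` is the optimal `P_{0 ← 0}` of Three-Outputs. -/
noncomputable def cubic (c a : ℝ) : ℝ := (2 - c - a) * (c - a) ^ 2 + (c + 1) ^ 2 / 2 * a * (c + a)

/-- The chord slopes of `cubic c` on `[0, 1]` are positive for `c ≥ 2`. Thus evaluating the cubic at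
a test point bounds its root. -/
theorem le_of_cubic {c a u : ℝ} (hc : 2 ≤ c) (ha : a ∈ Set.Icc (0 : ℝ) 1)
    (hu : u ∈ Set.Icc (0 : ℝ) 1) (h : cubic c a ≤ cubic c u) : a ≤ u := by
  by_contra! hlt
  have e : cubic c a - cubic c u = (a - u) * (-(a ^ 2 + a * u + u ^ 2)
      + (c ^ 2 + 4 * c + 5) / 2 * (a + u) + (c ^ 2 - 4 * c + c * (c + 1) ^ 2 / 2)) := by
    unfold cubic; ring
  have h2 : 0 < c ^ 2 - 4 * c + c * (c + 1) ^ 2 / 2 := by nlinarith [sq_nonneg (c - 2)]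
  have h3 : a ^ 2 + a * u + u ^ 2 ≤ (c ^ 2 + 4 * c + 5) / 2 * (a + u) := by
    have h4 : a ^ 2 ≤ a := by nlinarith [ha.1, ha.2]
    have h5 : u ^ 2 ≤ u := by nlinarith [hu.1, hu.2]
    have h6 : a * u ≤ a := by nlinarith [ha.1, hu.2]
    have h7 : 2 * (a + u) ≤ (c ^ 2 + 4 * c + 5) / 2 * (a + u) := by
      apply mul_le_mul_of_nonneg_right _ (add_nonneg ha.1 hu.1)
      nlinarith
    linarith [hu.1]
  have : 0 < cubic c a - cubic c u := by
    rw [e]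
    exact mul_pos (by linarith) (by linarith)
  linarith

/-- Viète's formula for the middle root of a depressed cubic. -/
theorem cos_arccos_root {Δ E y : ℝ} (hΔ : 0 < Δ) (hE : |E| ≤ 2 * √Δ ^ 3)
    (hy : y = 2 * √Δ * Real.cos (Real.pi / 3 + 1 / 3 * Real.arccos (-(E / (2 * √Δ ^ 3))))) :
    y ^ 3 - 3 * Δ * y = E ∧ |y| ≤ √Δ := by
  have hD : 0 < √Δ := Real.sqrt_pos.2 hΔ
  have hD2 : √Δ ^ 2 = Δ := Real.sq_sqrt hΔ.le
  have hD3 : 0 < 2 * √Δ ^ 3 := by positivity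
  obtain ⟨h1, h2⟩ := abs_le.1 hE
  have hcos := Real.cos_arccos (x := -(E / (2 * √Δ ^ 3)))
    (by rw [neg_le_neg_iff, div_le_one hD3]; exact h2)
    (by rw [neg_le, le_div_iff₀ hD3]; linarith)
  have hθ0 := Real.arccos_nonneg (-(E / (2 * √Δ ^ 3)))
  have hθ1 := Real.arccos_le_pi (-(E / (2 * √Δ ^ 3)))
  generalize Real.arccos (-(E / (2 * √Δ ^ 3))) = θ at *
  -- Tripling the angle gives `θ + π`; the resulting sign cancels the minus inside the arccosine.
  -- The angle itself lies in `[π/3, 2π/3]`, which selects the middle root.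
  have h3 := Real.cos_three_mul (Real.pi / 3 + 1 / 3 * θ)
  rw [show 3 * (Real.pi / 3 + 1 / 3 * θ) = θ + Real.pi by ring, Real.cos_add_pi, hcos,
    neg_neg] at h3
  have hpi := Real.pi_pos
  have hu : Real.cos (Real.pi / 3 + 1 / 3 * θ) ≤ 1 / 2 := by
    rw [← Real.cos_pi_div_three]
    exact Real.cos_le_cos_of_nonneg_of_le_pi (by linarith) (by linarith) (by linarith)
  have hl : -(1 / 2) ≤ Real.cos (Real.pi / 3 + 1 / 3 * θ) := by
    rw [← Real.cos_pi_div_three, ← Real.cos_pi_sub]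
    exact Real.cos_le_cos_of_nonneg_of_le_pi (by linarith) (by linarith) (by linarith)
  generalize Real.cos (Real.pi / 3 + 1 / 3 * θ) = γ at *
  constructor
  · rw [div_eq_iff hD3.ne'] at h3
    rw [hy, h3, ← hD2]
    rw [Real.sqrt_sq hD.le]
    ring
  · rw [hy, abs_le]
    constructor <;> nlinarith

theorem depressed_cubic_strictAntiOn {D x y : ℝ} (hx : |x| ≤ D) (hy : |y| ≤ D) (hxy : x < y) :
    y ^ 3 - 3 * D ^ 2 * y < x ^ 3 - 3 * D ^ 2 * x := by
  have hx2 : x ^ 2 ≤ D ^ 2 := sq_le_sq' (by linarith [(abs_le.1 hx).1]) (abs_le.1 hx).2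
  have hy2 : y ^ 2 ≤ D ^ 2 := sq_le_sq' (by linarith [(abs_le.1 hy).1]) (abs_le.1 hy).2
  have : 0 < (y - x) * (3 * D ^ 2 - (x ^ 2 + x * y + y ^ 2)) := by
    apply mul_pos (by linarith)
    nlinarith [sq_pos_of_pos (sub_pos.2 hxy)]
  nlinarith

theorem cubic_zero_nonpos {c : ℝ} (hc : 2 ≤ c) : cubic c 0 ≤ 0 := by
  unfold cubic
  nlinarith [sq_nonneg c]

/-- The substitution `y = c² + 4c + 5 - 6a` turns the cubic into `y³ - 3Δy = E`. The points `a = 0`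
and `a = 1` correspond to `|y| ≤ √Δ`, where the left side is strictly decreasing, and the cubic
changes sign between them; so the middle root gives `a` in `[0, 1]`. -/
theorem a_middle {ε : ℝ} (h1 : Real.log 2 ≤ ε) (h2 : ε ≤ epsPrime) :
    2 ≤ Real.exp ε ∧ Real.exp ε ≤ 5.54 ∧ a ε ∈ Set.Icc (0 : ℝ) 1 ∧
      cubic (Real.exp ε) (a ε) = 0 := by
  have hc2 : 2 ≤ Real.exp ε := by
    rwa [Real.log_le_iff_le_exp (by norm_num)] at h1
  have hs65 : √65 ≤ 8.08 := by
    rw [Real.sqrt_le_left (by norm_num)]; norm_num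
  have hc5 : Real.exp ε ≤ 5.54 := by
    rw [epsPrime, Real.le_log_iff_exp_le (by positivity)] at h2
    linarith
  refine ⟨hc2, hc5, ?_⟩
  rw [a, if_neg (not_lt.2 h1), if_pos h2]
  have hΔ : delta0 ε ^ (3 / 2 : ℝ) = √(delta0 ε) ^ 3 := by
    rw [Real.rpow_div_two_eq_sqrt _ (by
      unfold delta0
      nlinarith [sq_nonneg (Real.exp ε), Real.exp_pos ε, pow_pos (Real.exp_pos ε) 3,
        pow_pos (Real.exp_pos ε) 4])]
    norm_cast
  rw [hΔ]
  unfold delta1 delta0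
  generalize Real.exp ε = c at *
  obtain ⟨Δ, hΔd⟩ : ∃ Δ, Δ = c ^ 4 + 14 * c ^ 3 + 50 * c ^ 2 - 2 * c + 25 := ⟨_, rfl⟩
  obtain ⟨E, hEd⟩ : ∃ E, E = -2 * c ^ 6 - 42 * c ^ 5 - 270 * c ^ 4 - 404 * c ^ 3 - 918 * c ^ 2
    + 30 * c - 250 := ⟨_, rfl⟩
  rw [← hΔd, ← hEd]
  have hc3 : 0 < c ^ 3 := by positivity
  have hy0sq : (c ^ 2 + 4 * c + 5) ^ 2 ≤ Δ := by
    have : 0 ≤ c * (c ^ 2 + 4 * c - 7) := mul_nonneg (by linarith) (by nlinarith)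
    rw [hΔd]
    linarith
  have hΔ0 : 0 < Δ := lt_of_lt_of_le (by positivity) hy0sq
  have hD2 : √Δ ^ 2 = Δ := Real.sq_sqrt hΔ0.le
  have hD0 : 0 < √Δ := Real.sqrt_pos.2 hΔ0
  have hy0 : |c ^ 2 + 4 * c + 5| ≤ √Δ := by
    rw [abs_of_pos (by positivity)]
    exact Real.le_sqrt_of_sq_le hy0sq
  have hy1 : |c ^ 2 + 4 * c - 1| ≤ √Δ := by
    rw [abs_of_pos (by positivity)] at hy0
    rw [abs_of_pos (by nlinarith)]
    linarith
  have hcub : ∀ x : ℝ, (c ^ 2 + 4 * c + 5 - 6 * x) ^ 3 - 3 * √Δ ^ 2 * (c ^ 2 + 4 * c + 5 - 6 * x)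
      = E + 216 * cubic c x := by
    intro x
    rw [hD2, hΔd, hEd]
    unfold cubic
    ring
  have hN0 : cubic c 0 ≤ 0 := cubic_zero_nonpos hc2
  have hN1 : 0 < cubic c 1 := by
    unfold cubic
    have : 0 ≤ (c - 2) * (5.54 - c) := mul_nonneg (by linarith) (by linarith)
    nlinarith
  -- On `|y| ≤ √Δ` the depressed cubic stays within `±2 * √Δ ^ 3`, by the factorizations below; the
  -- signs of `cubic c 0` and `cubic c 1` transfer this to `E`.
  have hE : |E| ≤ 2 * √Δ ^ 3 := by
    have k0 := hcub 0
    have k1 := hcub 1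
    obtain ⟨l0, u0⟩ := abs_le.1 hy0
    obtain ⟨l1, u1⟩ := abs_le.1 hy1
    rw [abs_le]
    constructor
    · have : 0 ≤ (c ^ 2 + 4 * c + 5 - √Δ) ^ 2 * (c ^ 2 + 4 * c + 5 + 2 * √Δ) :=
        mul_nonneg (sq_nonneg _) (by linarith)
      linarith
    · have : 0 ≤ (√Δ + (c ^ 2 + 4 * c - 1)) ^ 2 * (2 * √Δ - (c ^ 2 + 4 * c - 1)) :=
        mul_nonneg (sq_nonneg _) (by linarith)
      linarith
  obtain ⟨hroot, habs⟩ := cos_arccos_root hΔ0 hE rfl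
  rw [show -(1 / 6) * (-c ^ 2 - 4 * c - 5 + 2 * √Δ *
      Real.cos (Real.pi / 3 + 1 / 3 * Real.arccos (-(E / (2 * √Δ ^ 3))))) =
      (c ^ 2 + 4 * c + 5 - 2 * √Δ *
      Real.cos (Real.pi / 3 + 1 / 3 * Real.arccos (-(E / (2 * √Δ ^ 3))))) / 6 by ring]
  generalize 2 * √Δ * Real.cos (Real.pi / 3 + 1 / 3 * Real.arccos (-(E / (2 * √Δ ^ 3)))) = y at *
  have hy := hcub ((c ^ 2 + 4 * c + 5 - y) / 6)
  rw [show c ^ 2 + 4 * c + 5 - 6 * ((c ^ 2 + 4 * c + 5 - y) / 6) = y by ring] at hy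
  refine ⟨⟨?_, ?_⟩, ?_⟩
  · by_contra! h
    have := depressed_cubic_strictAntiOn hy0 habs (by linarith)
    have k0 := hcub 0
    rw [mul_zero, sub_zero] at k0
    rw [hD2] at *
    linarith
  · by_contra! h
    have := depressed_cubic_strictAntiOn habs hy1 (by linarith)
    have k1 := hcub 1
    rw [show c ^ 2 + 4 * c + 5 - 6 * 1 = c ^ 2 + 4 * c - 1 by ring] at k1
    rw [hD2] at *
    linarith
  · rw [hD2] at hy
    linarith

/-! ### Polynomial bounds in the trigonometric range of `a` -/

/-- Bernstein basis products on `[l, u]`: `linarith` proves a univariate polynomial inequality on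
the interval by finding a nonnegative combination of them. -/
theorem bernstein_nonneg {x l u : ℝ} (hl : l ≤ x) (hu : x ≤ u) (i j : ℕ) :
    0 ≤ (x - l) ^ i * (u - x) ^ j :=
  mul_nonneg (pow_nonneg (sub_nonneg.2 hl) i) (pow_nonneg (sub_nonneg.2 hu) j)

/-- PM-SUB has at least the variance of Three-Outputs at `1`, cleared of denominators. -/
theorem root_le_one {t a : ℝ} (ht : 1 < t) (ha : a < t ^ 3)
    (h : 3 * t ^ 3 * (t ^ 3 + 1) ^ 2 ≤
      (t ^ 2 + 1) * (3 * t ^ 4 + 2 * t ^ 2 + 3) * (t ^ 3 - a)) :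
    0 ≤ (t ^ 3 + t) / (t ^ 3 - 1) - slope (t ^ 3) a
      + (pmVarZero (t ^ 3) t - toVarZero (t ^ 3) a) := by
  have hc : 0 < t ^ 3 - 1 := by
    have := one_lt_pow₀ ht (n := 3) (by norm_num)
    linarith
  have hca : 0 < t ^ 3 - a := by linarith
  have e : (t ^ 3 + t) / (t ^ 3 - 1) - slope (t ^ 3) a
      + (pmVarZero (t ^ 3) t - toVarZero (t ^ 3) a)
      = ((t ^ 2 + 1) * (3 * t ^ 4 + 2 * t ^ 2 + 3) * (t ^ 3 - a) - 3 * t ^ 3 * (t ^ 3 + 1) ^ 2)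
        / (3 * (t ^ 3 - 1) ^ 2 * (t ^ 3 - a)) := by
    unfold slope pmVarZero toVarZero
    have := hc.ne'
    have := hca.ne'
    have : t ≠ 0 := by linarith
    field_simp
    ring
  rw [e]
  exact div_nonneg (by linarith) (by positivity)

/-- PM-SUB has at most the variance of Three-Outputs at `s`, where `2 * s` is the slope. -/
theorem half_slope_le_root {t a s : ℝ} (ht : 1 < t) (hs : slope (t ^ 3) a = 2 * s)
    (h : (t ^ 2 + 1) * (2 * t ^ 2 + 3 * t + 3) / 3 + (t + 2 - t ^ 3) * ((t ^ 3 - 1) * s ^ 2) ≤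
      (t ^ 3) ^ 2 * (t ^ 3 + 1) ^ 2 * (1 - a) / (t ^ 3 - a) ^ 2) :
    (t ^ 3 + t) / (t ^ 3 - 1) * slope (t ^ 3) a ^ 2 / 4 - slope (t ^ 3) a ^ 2 / 2
      + (pmVarZero (t ^ 3) t - toVarZero (t ^ 3) a) ≤ 0 := by
  have hc : 0 < t ^ 3 - 1 := by
    have := one_lt_pow₀ ht (n := 3) (by norm_num)
    linarith
  have hT : toVarZero (t ^ 3) a
      = (t ^ 3) ^ 2 * (t ^ 3 + 1) ^ 2 * (1 - a) / (t ^ 3 - a) ^ 2 / (t ^ 3 - 1) ^ 2 := by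
    rw [div_div, mul_comm ((t ^ 3 - a) ^ 2)]
    rfl
  have hP : pmVarZero (t ^ 3) t
      = (t ^ 2 + 1) * (2 * t ^ 2 + 3 * t + 3) / 3 / (t ^ 3 - 1) ^ 2 := by
    unfold pmVarZero
    have := hc.ne'
    have : t ≠ 0 := by linarith
    field_simp
    ring
  have hK : (t ^ 3 + t) / (t ^ 3 - 1) * (2 * s) ^ 2 / 4 - (2 * s) ^ 2 / 2
      = (t + 2 - t ^ 3) * ((t ^ 3 - 1) * s ^ 2) / (t ^ 3 - 1) ^ 2 := by
    have := hc.ne'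
    field_simp
    ring
  have := div_le_div_of_nonneg_right h (sq_nonneg (t ^ 3 - 1))
  rw [add_div] at this
  rw [hs, hK, hT, hP]
  linarith

/-- The cubic equation eliminates `(c - a) ^ 2`, leaving an expression monotone in `a`, so bounds on
the root carry over to the slope. -/
theorem slope_of_cubic {c a : ℝ} (hc : 2 ≤ c) (ha : a ∈ Set.Icc (0 : ℝ) 1) (h : cubic c a = 0) :
    slope c a = 2 * (c * (c + a - 2) / ((c - 1) * (c + a))) := by
  have h1 : 0 < c - a := by linarith [ha.2]
  have h2 : 0 < c - 1 := by linarith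
  have h3 : 0 < c + a := by linarith [ha.1]
  unfold slope
  unfold cubic at h
  rw [← mul_div_assoc, div_eq_div_iff (by positivity) (by positivity)]
  linear_combination (2 * c * (c - 1)) * h

theorem one_sub_div_sq_anti {c a u : ℝ} (hc : 2 ≤ c) (ha : 0 ≤ a) (hau : a ≤ u) (hu : u ≤ 1) :
    (1 - u) / (c - u) ^ 2 ≤ (1 - a) / (c - a) ^ 2 := by
  rw [div_le_div_iff₀ (by nlinarith) (by nlinarith)]
  have h1 : 0 ≤ c * (c - 2) := mul_nonneg (by linarith) (by linarith)
  have h2 : 0 ≤ a * (1 - u) := mul_nonneg ha (by linarith)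
  have h3 : 0 ≤ (u - a) * (c * (c - 2) + u + a * (1 - u)) :=
    mul_nonneg (by linarith) (by linarith)
  linarith

/-- This bound and the next two are linear in `c = t ^ 3`; they remove the cube root, leaving
inequalities in `c` alone. -/
theorem pm_quartic_le {t : ℝ} (hl : 1.259 ≤ t) (hu : t ≤ 1.77) :
    (t ^ 2 + 1) * (2 * t ^ 2 + 3 * t + 3) / 3 ≤ 2.11 + 3.245 * t ^ 3 := by
  linarith [bernstein_nonneg hl hu 0 4, bernstein_nonneg hl hu 1 3, bernstein_nonneg hl hu 2 2,
    bernstein_nonneg hl hu 3 1, bernstein_nonneg hl hu 4 0]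

theorem le_linear_cube_of_le {t : ℝ} (hl : 1.259 ≤ t) (hu : t ≤ 1.53) :
    t + 2 - t ^ 3 ≤ 2.91 - 0.82 * t ^ 3 := by
  linarith [bernstein_nonneg hl hu 0 6, bernstein_nonneg hl hu 1 5, bernstein_nonneg hl hu 2 4,
    bernstein_nonneg hl hu 3 3, bernstein_nonneg hl hu 4 2, bernstein_nonneg hl hu 5 1,
    bernstein_nonneg hl hu 6 0]

theorem le_linear_cube_of_ge {t : ℝ} (hl : 1.5 ≤ t) (hu : t ≤ 1.77) :
    t + 2 - t ^ 3 ≤ 3.1775 - 0.893 * t ^ 3 := by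
  linarith [bernstein_nonneg hl hu 0 3, bernstein_nonneg hl hu 1 2, bernstein_nonneg hl hu 2 1,
    bernstein_nonneg hl hu 3 0]

/-- An upper bound for the root of `cubic c` in `[0, 1]`, for `2 ≤ c ≤ 3.53`. -/
theorem root_le_of_le {c a : ℝ} (hl : 2 ≤ c) (hu : c ≤ 3.53) (ha : a ∈ Set.Icc (0 : ℝ) 1)
    (h : cubic c a = 0) : a ≤ 0.15 + 0.2233 * (c - 2) := by
  refine le_of_cubic hl ha ⟨by linarith, by linarith⟩ ?_
  rw [h, cubic]
  linarith [bernstein_nonneg hl hu 0 4, bernstein_nonneg hl hu 1 3, bernstein_nonneg hl hu 2 2,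
    bernstein_nonneg hl hu 3 1, bernstein_nonneg hl hu 4 0]

/-- An upper bound for the root of `cubic c` in `[0, 1]`, for `3.53 ≤ c ≤ 5.54`. -/
theorem root_le_of_ge {c a : ℝ} (hl : 3.53 ≤ c) (hu : c ≤ 5.54) (ha : a ∈ Set.Icc (0 : ℝ) 1)
    (h : cubic c a = 0) : a ≤ 0.7335 + 0.117 * (c - 5.5) := by
  refine le_of_cubic (c := c) (by linarith) ha ⟨by linarith, by linarith⟩ ?_
  rw [h, cubic]
  linarith [bernstein_nonneg hl hu 0 7, bernstein_nonneg hl hu 1 6, bernstein_nonneg hl hu 2 5,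
    bernstein_nonneg hl hu 3 4, bernstein_nonneg hl hu 4 3, bernstein_nonneg hl hu 5 2,
    bernstein_nonneg hl hu 6 1, bernstein_nonneg hl hu 7 0]

theorem le_root_of_ge {c a : ℝ} (hl : 3.53 ≤ c) (hu : c ≤ 5.54) (ha : a ∈ Set.Icc (0 : ℝ) 1)
    (h : cubic c a = 0) : 0.4 ≤ a := by
  refine le_of_cubic (c := c) (by linarith) ⟨by norm_num, by norm_num⟩ ha ?_
  rw [h, cubic]
  linarith [bernstein_nonneg hl hu 0 3, bernstein_nonneg hl hu 1 2, bernstein_nonneg hl hu 2 1,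
    bernstein_nonneg hl hu 3 0]

theorem half_slope_sq {c a : ℝ} (hc : 2 ≤ c) (ha : 0 ≤ a) :
    (c - 1) * (c * (c + a - 2) / ((c - 1) * (c + a))) ^ 2
      = c ^ 2 * ((c + a - 2) / (c + a)) ^ 2 / (c - 1) := by
  have h2 : c - 1 ≠ 0 := by linarith
  have h3 : c + a ≠ 0 := by linarith
  field_simp

theorem half_slope_mono {c a u : ℝ} (hc : 2 ≤ c) (ha : 0 ≤ a) (hau : a ≤ u) :
    (c - 1) * (c * (c + a - 2) / ((c - 1) * (c + a))) ^ 2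
      ≤ (c - 1) * (c * (c + u - 2) / ((c - 1) * (c + u))) ^ 2 := by
  rw [half_slope_sq hc ha, half_slope_sq hc (ha.trans hau)]
  have h2 : 0 < c - 1 := by linarith
  have h3 : 0 ≤ (c + a - 2) / (c + a) := div_nonneg (by linarith) (by linarith)
  have h4 : (c + a - 2) / (c + a) ≤ (c + u - 2) / (c + u) := by
    rw [div_le_div_iff₀ (by linarith) (by linarith)]
    linarith
  gcongr

theorem half_slope_le_of_le {c : ℝ} (hl : 2 ≤ c) (hu : c ≤ 3.53) {u : ℝ}
    (h : u = 0.15 + 0.2233 * (c - 2)) :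
    (c - 1) * (c * (c + u - 2) / ((c - 1) * (c + u))) ^ 2 ≤ 0.8 * (c - 1.9) := by
  have h2 : 0 < c - 1 := by linarith
  have h3 : 0 < c + u := by rw [h]; linarith
  rw [half_slope_sq hl (by rw [h]; linarith), div_pow, ← mul_div_assoc, div_div,
    div_le_iff₀ (by positivity), h]
  linarith [bernstein_nonneg hl hu 0 4, bernstein_nonneg hl hu 1 3, bernstein_nonneg hl hu 2 2,
    bernstein_nonneg hl hu 3 1, bernstein_nonneg hl hu 4 0]

theorem le_half_slope_of_ge {c : ℝ} (hl : 3.53 ≤ c) (hu : c ≤ 5.54) :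
    1.1 + 0.92 * (c - 3.53) ≤ (c - 1) * (c * (c + 0.4 - 2) / ((c - 1) * (c + 0.4))) ^ 2 := by
  have h2 : 0 < c - 1 := by linarith
  have h3 : 0 < c + 0.4 := by linarith
  rw [half_slope_sq (by linarith) (by norm_num), div_pow, ← mul_div_assoc, div_div,
    le_div_iff₀ (by positivity)]
  linarith [bernstein_nonneg hl hu 0 4, bernstein_nonneg hl hu 1 3, bernstein_nonneg hl hu 2 2,
    bernstein_nonneg hl hu 3 1, bernstein_nonneg hl hu 4 0]

theorem middle_bound_of_le {c u : ℝ} (hl : 2 ≤ c) (hu : c ≤ 3.53)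
    (h : u = 0.15 + 0.2233 * (c - 2)) :
    2.11 + 3.245 * c + (2.91 - 0.82 * c) * (0.8 * (c - 1.9))
      ≤ c ^ 2 * (c + 1) ^ 2 * ((1 - u) / (c - u) ^ 2) := by
  have h3 : 0 < c - u := by rw [h]; linarith
  rw [← mul_div_assoc, le_div_iff₀ (by positivity), h]
  linarith [bernstein_nonneg hl hu 0 5, bernstein_nonneg hl hu 1 4, bernstein_nonneg hl hu 2 3,
    bernstein_nonneg hl hu 3 2, bernstein_nonneg hl hu 4 1, bernstein_nonneg hl hu 5 0]

theorem middle_bound_of_ge {c u : ℝ} (hl : 3.53 ≤ c) (hu : c ≤ 5.54)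
    (h : u = 0.7335 + 0.117 * (c - 5.5)) :
    2.11 + 3.245 * c + (3.1775 - 0.893 * c) * (1.1 + 0.92 * (c - 3.53))
      ≤ c ^ 2 * (c + 1) ^ 2 * ((1 - u) / (c - u) ^ 2) := by
  have h3 : 0 < c - u := by rw [h]; linarith
  rw [← mul_div_assoc, le_div_iff₀ (by positivity), h]
  linarith [bernstein_nonneg hl hu 0 5, bernstein_nonneg hl hu 1 4, bernstein_nonneg hl hu 2 3,
    bernstein_nonneg hl hu 3 2, bernstein_nonneg hl hu 4 1, bernstein_nonneg hl hu 5 0]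

/-- Two-sided bounds on the cube root. -/
theorem cube_root_bounds {t l u : ℝ} (ht : 0 ≤ t) (hl : l ^ 3 ≤ t ^ 3) (hu : t ^ 3 ≤ u ^ 3)
    (hu0 : 0 ≤ u) : l ≤ t ∧ t ≤ u :=
  ⟨le_of_pow_le_pow_left₀ (by norm_num) ht hl, le_of_pow_le_pow_left₀ (by norm_num) hu0 hu⟩

theorem middle_conditions {t a : ℝ} (ht : 0 ≤ t) (h2 : 2 ≤ t ^ 3) (h5 : t ^ 3 ≤ 5.54)
    (ha : a ∈ Set.Icc (0 : ℝ) 1) (h : cubic (t ^ 3) a = 0) :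
    slope (t ^ 3) a ≤ 2 ∧
    0 ≤ (t ^ 3 + t) / (t ^ 3 - 1) - slope (t ^ 3) a
      + (pmVarZero (t ^ 3) t - toVarZero (t ^ 3) a) ∧
    (t ^ 3 + t) / (t ^ 3 - 1) * slope (t ^ 3) a ^ 2 / 4 - slope (t ^ 3) a ^ 2 / 2
      + (pmVarZero (t ^ 3) t - toVarZero (t ^ 3) a) ≤ 0 := by
  have hsl := slope_of_cubic h2 ha h
  obtain ⟨ht1, ht2⟩ := cube_root_bounds (l := 1.259) (u := 1.77) ht (by linarith) (by linarith)
    (by norm_num)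
  have hM := pm_quartic_le ht1 ht2
  refine ⟨?_, ?_, half_slope_le_root (by linarith) hsl ?_⟩
  · have h3 : 0 < t ^ 3 - 1 := by linarith
    have h4 : 0 < t ^ 3 + a := by linarith [ha.1]
    have : t ^ 3 * (t ^ 3 + a - 2) / ((t ^ 3 - 1) * (t ^ 3 + a)) ≤ 1 := by
      rw [div_le_one (by positivity)]
      linarith [ha.2]
    linarith
  · apply root_le_one (by linarith) (by linarith [ha.2])
    have hG : 0 ≤ (t ^ 2 + 1) * (3 * t ^ 4 + 2 * t ^ 2 + 3) := by positivity
    rcases le_total (t ^ 3) 3.53 with h3 | h3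
    · have hau := mul_le_mul_of_nonneg_left (root_le_of_le h2 h3 ha h) hG
      obtain ⟨hl, hu⟩ := cube_root_bounds (l := 1.259) (u := 1.53) ht (by linarith) (by linarith)
        (by norm_num)
      linarith [bernstein_nonneg hl hu 0 9, bernstein_nonneg hl hu 1 8, bernstein_nonneg hl hu 2 7,
        bernstein_nonneg hl hu 3 6, bernstein_nonneg hl hu 4 5, bernstein_nonneg hl hu 5 4,
        bernstein_nonneg hl hu 6 3, bernstein_nonneg hl hu 7 2, bernstein_nonneg hl hu 8 1,
        bernstein_nonneg hl hu 9 0]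
    · have hau := mul_le_mul_of_nonneg_left (root_le_of_ge h3 h5 ha h) hG
      obtain ⟨hl, hu⟩ := cube_root_bounds (l := 1.52) (u := 1.77) ht (by linarith) (by linarith)
        (by norm_num)
      linarith [bernstein_nonneg hl hu 0 9, bernstein_nonneg hl hu 1 8, bernstein_nonneg hl hu 2 7,
        bernstein_nonneg hl hu 3 6, bernstein_nonneg hl hu 4 5, bernstein_nonneg hl hu 5 4,
        bernstein_nonneg hl hu 6 3, bernstein_nonneg hl hu 7 2, bernstein_nonneg hl hu 8 1,
        bernstein_nonneg hl hu 9 0]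
  · rw [mul_div_assoc ((t ^ 3) ^ 2 * (t ^ 3 + 1) ^ 2)]
    -- The factor `t + 2 - t ^ 3` changes sign near `t ^ 3 = 3.52`. Below the split the squared
    -- half-slope is bounded from above; past it the factor is nonpositive and a lower bound is
    -- needed.
    rcases le_total (t ^ 3) 3.53 with h3 | h3
    · obtain ⟨hl, hu⟩ := cube_root_bounds (l := 1.259) (u := 1.53) ht (by linarith) (by linarith)
        (by norm_num)
      have hau := root_le_of_le h2 h3 ha h
      have hT := le_linear_cube_of_le hl hu
      have hr := (half_slope_mono h2 ha.1 hau).trans (half_slope_le_of_le h2 h3 rfl)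
      have hr0 : 0 ≤ (t ^ 3 - 1) * (t ^ 3 * (t ^ 3 + a - 2) / ((t ^ 3 - 1) * (t ^ 3 + a))) ^ 2 :=
        mul_nonneg (by linarith) (sq_nonneg _)
      have hprod := mul_le_mul hT hr hr0 (by linarith)
      have hfin := (middle_bound_of_le h2 h3 rfl).trans
        (mul_le_mul_of_nonneg_left (one_sub_div_sq_anti h2 ha.1 hau (by linarith)) (by positivity))
      linarith
    · obtain ⟨hl, hu⟩ := cube_root_bounds (l := 1.522) (u := 1.77) ht (by linarith) (by linarith)
        (by norm_num)
      have hau := root_le_of_ge h3 h5 ha h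
      have hT := le_linear_cube_of_ge (by linarith) hu
      have hr := (le_half_slope_of_ge h3 h5).trans
        (half_slope_mono h2 (by norm_num) (le_root_of_ge h3 h5 ha h))
      have hT0 : t + 2 - t ^ 3 ≤ 0 := by
        have : 0 ≤ (t - 1.522) * (t ^ 2 + 1.522 * t + 1.3) :=
          mul_nonneg (by linarith) (by positivity)
        linarith
      have h6 := mul_le_mul_of_nonpos_left hr hT0
      have h7 := mul_le_mul_of_nonneg_right hT
        (show (0 : ℝ) ≤ 1.1 + 0.92 * (t ^ 3 - 3.53) by linarith)
      have hfin := (middle_bound_of_ge h3 h5 rfl).trans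
        (mul_le_mul_of_nonneg_left (one_sub_div_sq_anti h2 ha.1 hau (by linarith)) (by positivity))
      linarith

/-! ### The range where `a = c / (c + 2)` -/

theorem large_conditions {t : ℝ} (ht : 1.76 ≤ t) {a : ℝ} (ha : a = t ^ 3 / (t ^ 3 + 2)) :
    slope (t ^ 3) a ≤ 2 ∧
    0 ≤ (t ^ 3 + t) / (t ^ 3 - 1) - slope (t ^ 3) a
      + (pmVarZero (t ^ 3) t - toVarZero (t ^ 3) a) ∧
    (t ^ 3 + t) / (t ^ 3 - 1) * slope (t ^ 3) a ^ 2 / 4 - slope (t ^ 3) a ^ 2 / 2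
      + (pmVarZero (t ^ 3) t - toVarZero (t ^ 3) a) ≤ 0 := by
  have hc : 5 < t ^ 3 := by
    have := pow_le_pow_left₀ (by norm_num) ht 3
    norm_num at this
    linarith
  have hc1 : 0 < t ^ 3 - 1 := by linarith
  have hca : t ^ 3 - a = t ^ 3 * (t ^ 3 + 1) / (t ^ 3 + 2) := by
    rw [ha]; field_simp; ring
  have hsl : slope (t ^ 3) a = 2 * ((t ^ 3 + 2) / (2 * (t ^ 3 - 1))) := by
    unfold slope
    rw [hca, ha]
    have := hc1.ne'
    field_simp
  have ht0 : 0 ≤ t - 1.76 := by linarith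
  -- Shifting the range to `y ≥ 0` reduces the remaining polynomial inequalities to nonnegativity of
  -- powers of `y`.
  obtain ⟨y, rfl⟩ : ∃ y, t = y + 1.76 := ⟨t - 1.76, by ring⟩
  have hy : 0 ≤ y := by linarith
  refine ⟨?_, root_le_one (by linarith) ?_ ?_, half_slope_le_root (by linarith) hsl ?_⟩
  · rw [hsl, ← mul_div_assoc, div_le_iff₀ (by positivity)]
    linarith
  · have : 0 < (y + 1.76) ^ 3 - a := by rw [hca]; positivity
    linarith
  · rw [hca, ← mul_div_assoc, le_div_iff₀ (by positivity)]
    have h1 : 0 ≤ 5 * (y + 1.76) ^ 4 - 9 * (y + 1.76) ^ 3 + 5 * (y + 1.76) ^ 2 - 3 := by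
      have : 0 ≤ 5 * y ^ 4 + 26 * y ^ 3 + 50 * y ^ 2 + 43 * y + 11 := by positivity
      nlinarith [sq_nonneg y, pow_nonneg hy 3, pow_nonneg hy 4]
    have h2 : 0 ≤ (y + 1.76) ^ 3 * ((y + 1.76) ^ 3 + 1) := by positivity
    linarith [mul_nonneg h2 h1]
  · have hR : ((y + 1.76) ^ 3) ^ 2 * ((y + 1.76) ^ 3 + 1) ^ 2 * (1 - a) / ((y + 1.76) ^ 3 - a) ^ 2
        = 2 * ((y + 1.76) ^ 3 + 2) := by
      have : 1 - a = 2 / ((y + 1.76) ^ 3 + 2) := by rw [ha]; field_simp; ring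
      rw [hca, this]
      field_simp
    have hL : ((y + 1.76) ^ 3 - 1) * (((y + 1.76) ^ 3 + 2) / (2 * ((y + 1.76) ^ 3 - 1))) ^ 2
        = ((y + 1.76) ^ 3 + 2) ^ 2 / (4 * ((y + 1.76) ^ 3 - 1)) := by
      have := hc1.ne'
      field_simp
      norm_num
    rw [hR, hL, ← mul_div_assoc, ← le_sub_iff_add_le', div_le_iff₀ (by positivity)]
    linarith [pow_nonneg hy 2, pow_nonneg hy 3, pow_nonneg hy 4, pow_nonneg hy 5, pow_nonneg hy 6,
      pow_nonneg hy 7, pow_nonneg hy 8, pow_nonneg hy 9]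

/-! ### The threshold `epsStar` -/

/-- The quintic that determines `epsStar`. -/
def quintic (x : ℝ) : ℝ := 3 * x ^ 5 - 2 * x ^ 3 + 3 * x ^ 2 - 5 * x - 3

theorem quintic_strictMonoOn : StrictMonoOn quintic (Set.Ici 1) := by
  intro x hx y hy hxy
  rw [Set.mem_Ici] at hx hy
  have e : quintic y - quintic x = (y - x) * (3 * (y ^ 4 + y ^ 3 * x + y ^ 2 * x ^ 2 + y * x ^ 3
      + x ^ 4) - 2 * (y ^ 2 + y * x + x ^ 2) + 3 * (y + x) - 5) := by
    unfold quintic; ring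
  have h1 : y ^ 2 ≤ y ^ 4 := pow_le_pow_right₀ hy (by norm_num)
  have h2 : x ^ 2 ≤ x ^ 4 := pow_le_pow_right₀ hx (by norm_num)
  have hyx : 1 ≤ y * x := one_le_mul_of_one_le_of_one_le hy hx
  have h3 : y * x ≤ y ^ 2 * x ^ 2 := by nlinarith
  have h4 : 0 ≤ y ^ 3 * x := by positivity
  have h5 : 0 ≤ y * x ^ 3 := by positivity
  have : 0 < quintic y - quintic x := by
    rw [e]
    exact mul_pos (by linarith) (by nlinarith)
  linarith

theorem epsStar_bounds : ∃ r : ℝ, quintic r = 0 ∧ 1.2258835 < r ∧ r < 1.2258841 ∧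
    epsStar = 3 * Real.log r := by
  obtain ⟨⟨h1, h2⟩, -⟩ := existsUnique_root.choose_spec
  refine ⟨existsUnique_root.choose, h2, ?_, ?_, rfl⟩
  all_goals
    change quintic _ = 0 at h2
    generalize existsUnique_root.choose = r at *
    have hr : r ∈ Set.Ici (1 : ℝ) := by
      rw [Set.mem_Ici]
      linarith [(abs_lt.1 h1).1]
  · rw [← quintic_strictMonoOn.lt_iff_lt (Set.mem_Ici.2 (by norm_num)) hr, h2]
    norm_num [quintic]
  · rw [← quintic_strictMonoOn.lt_iff_lt hr (Set.mem_Ici.2 (by norm_num)), h2]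
    norm_num [quintic]

theorem abs_epsStar_sub_lt : |epsStar - 0.610986| < 1 / 10 ^ 6 := by
  obtain ⟨r, -, h1, h2, he⟩ := epsStar_bounds
  have hr : 0 < r := by linarith
  -- Taylor bounds of the exponential are compared with the rational bracket of `r`.
  have hl : (0.610985 : ℝ) / 3 < Real.log r := by
    rw [Real.lt_log_iff_exp_lt hr]
    refine lt_of_le_of_lt (Real.exp_bound' (by norm_num) (by norm_num) (n := 8) (by norm_num)) ?_
    refine lt_of_le_of_lt ?_ h1
    norm_num [Finset.sum_range_succ, Nat.factorial]
  have hu : Real.log r < (0.610987 : ℝ) / 3 := by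
    rw [Real.log_lt_iff_lt_exp hr]
    refine lt_of_lt_of_le ?_ (Real.sum_le_exp_of_nonneg (by norm_num) 8)
    refine h2.trans_le ?_
    norm_num [Finset.sum_range_succ, Nat.factorial]
  rw [he, abs_lt]
  constructor <;> linarith

theorem epsStar_lt_log_two : epsStar < Real.log 2 := by
  have h := (abs_lt.1 abs_epsStar_sub_lt).2
  have := Real.log_two_gt_d9
  norm_num at h
  linarith

theorem lt_epsStar_iff {ε : ℝ} (hε : 0 < ε) : ε < epsStar ↔ quintic (Real.exp (ε / 3)) < 0 := by
  obtain ⟨r, h0, h1, -, he⟩ := epsStar_bounds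
  have ht : 1 < Real.exp (ε / 3) := Real.one_lt_exp_iff.2 (by linarith)
  rw [he, ← h0, quintic_strictMonoOn.lt_iff_lt ht.le (Set.mem_Ici.2 (by linarith)),
    ← Real.lt_log_iff_exp_lt (by linarith)]
  constructor <;> intro h <;> linarith

theorem exp_eq_cube (ε : ℝ) : Real.exp ε = Real.exp (ε / 3) ^ 3 := by
  rw [← Real.exp_nat_mul]
  congr 1
  push_cast
  ring

theorem slope_zero (c : ℝ) : slope c 0 = 0 := by simp [slope]

/-- This explains the quintic: with `a = 0`, its sign decides which mechanism has the smaller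
variance at input `0`. -/
theorem pmVarZero_sub_toVarZero {t : ℝ} (ht : 1 < t) :
    pmVarZero (t ^ 3) t - toVarZero (t ^ 3) 0 = -(t * quintic t / (3 * (t ^ 3 - 1) ^ 2)) := by
  have hc : 0 < t ^ 3 - 1 := by
    have := one_lt_pow₀ ht (n := 3) (by norm_num)
    linarith
  have := hc.ne'
  have : t ≠ 0 := by linarith
  unfold pmVarZero toVarZero quintic
  field_simp
  ring

/-! ### Verification over all ranges of `ε` -/

theorem a_mem_Icc (ε : ℝ) : a ε ∈ Set.Icc (0 : ℝ) 1 := by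
  rcases lt_or_ge ε (Real.log 2) with h | h
  · simp [a, h]
  rcases le_or_gt ε epsPrime with h' | h'
  · exact (a_middle h h').2.2.1
  · have := Real.exp_pos ε
    rw [a, if_neg (not_lt.2 h), if_neg (not_le.2 h')]
    exact ⟨by positivity, (div_le_one (by positivity)).2 (by linarith)⟩

theorem conditions_of_log_two_le {ε : ℝ} (h : Real.log 2 ≤ ε) :
    slope (Real.exp ε) (a ε) ≤ 2 ∧
    0 ≤ (Real.exp ε + Real.exp (ε / 3)) / (Real.exp ε - 1) - slope (Real.exp ε) (a ε)
      + (pmVarZero (Real.exp ε) (Real.exp (ε / 3)) - toVarZero (Real.exp ε) (a ε)) ∧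
    (Real.exp ε + Real.exp (ε / 3)) / (Real.exp ε - 1) * slope (Real.exp ε) (a ε) ^ 2 / 4
      - slope (Real.exp ε) (a ε) ^ 2 / 2
      + (pmVarZero (Real.exp ε) (Real.exp (ε / 3)) - toVarZero (Real.exp ε) (a ε)) ≤ 0 := by
  rcases le_or_gt ε epsPrime with h' | h'
  · obtain ⟨h2, h5, ha, hroot⟩ := a_middle h h'
    rw [exp_eq_cube ε] at *
    exact middle_conditions (Real.exp_pos _).le h2 h5 ha hroot
  · have ha : a ε = Real.exp ε / (Real.exp ε + 2) := by
      rw [a, if_neg (not_lt.2 h), if_neg (not_le.2 h')]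
    have hs65 : 8.06 ≤ √65 := Real.le_sqrt_of_sq_le (by norm_num)
    rw [epsPrime, Real.log_lt_iff_lt_exp (by positivity)] at h'
    rw [exp_eq_cube ε] at *
    refine large_conditions ?_ ha
    -- Here `1.76 ^ 3 < 5.53 = (3 + 8.06) / 2`.
    refine le_of_pow_le_pow_left₀ (n := 3) (by norm_num) (Real.exp_pos _).le ?_
    linarith

theorem conditions_of_lt_log_two {ε : ℝ} (hε : 0 < ε) (h : ε < Real.log 2) (h' : epsStar ≤ ε) :
    slope (Real.exp ε) (a ε) ≤ 2 ∧
    0 ≤ (Real.exp ε + Real.exp (ε / 3)) / (Real.exp ε - 1) - slope (Real.exp ε) (a ε)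
      + (pmVarZero (Real.exp ε) (Real.exp (ε / 3)) - toVarZero (Real.exp ε) (a ε)) ∧
    (Real.exp ε + Real.exp (ε / 3)) / (Real.exp ε - 1) * slope (Real.exp ε) (a ε) ^ 2 / 4
      - slope (Real.exp ε) (a ε) ^ 2 / 2
      + (pmVarZero (Real.exp ε) (Real.exp (ε / 3)) - toVarZero (Real.exp ε) (a ε)) ≤ 0 := by
  have ha : a ε = 0 := by rw [a, if_pos h]
  have ht : 1 < Real.exp (ε / 3) := Real.one_lt_exp_iff.2 (by linarith)
  have hq := mt (lt_epsStar_iff hε).2 (not_lt.2 h')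
  rw [not_lt] at hq
  rw [ha, exp_eq_cube ε]
  generalize Real.exp (ε / 3) = t at *
  refine ⟨by rw [slope_zero]; norm_num, root_le_one ht (by positivity) ?_, ?_⟩
  · have : 0 ≤ t ^ 5 * (5 * (t - 1) ^ 2 + 4 * (t - 1) + 4) := by
      have : 0 < t - 1 := by linarith
      positivity
    linarith
  · rw [slope_zero, pmVarZero_sub_toVarZero ht]
    have : 0 ≤ t * quintic t / (3 * (t ^ 3 - 1) ^ 2) := by positivity
    linarith

theorem isMinOn_worstVar_zero {ε : ℝ} (hε : 0 < ε) (h : ε < epsStar) :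
    IsMinOn (worstVar ε) (Set.Icc 0 1) 0 := by
  have ha : a ε = 0 := by rw [a, if_pos (h.trans epsStar_lt_log_two)]
  have ht : 1 < Real.exp (ε / 3) := Real.one_lt_exp_iff.2 (by linarith)
  have hq := (lt_epsStar_iff hε).1 h
  have hform := fun β x => hmVar_formula (β := β) (x := x) hε (a_mem_Icc ε).1 (a_mem_Icc ε).2
  have h0 : (0 : ℝ) ∈ Set.Icc (-1 : ℝ) 1 := by norm_num
  have h0' : (0 : ℝ) ∈ Set.Icc (0 : ℝ) 1 := by norm_num
  rw [ha, slope_zero, exp_eq_cube ε, pmVarZero_sub_toVarZero ht] at hform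
  refine isMinOn_worstVar hε (a_mem_Icc ε).1 (a_mem_Icc ε).2 h0' h0 ?_ ?_
  · intro x hx
    rw [hform 0 x h0' hx, hform 0 0 h0' h0, abs_zero]
    linarith [sq_nonneg |x|]
  · intro β hβ
    rw [hform 0 0 h0' h0, hform β 0 hβ h0, abs_zero]
    have : 0 ≤ β * (Real.exp (ε / 3) * -quintic (Real.exp (ε / 3))
        / (3 * (Real.exp (ε / 3) ^ 3 - 1) ^ 2)) := by
      have := hβ.1
      have : 0 ≤ -quintic (Real.exp (ε / 3)) := by linarith
      positivity
    rw [mul_neg, neg_div] at this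
    linarith

theorem betaOpt_spec {ε : ℝ} (hε : 0 < ε) :
    betaOpt ε ∈ Set.Icc (0 : ℝ) 1 ∧ IsMinOn (worstVar ε) (Set.Icc 0 1) (betaOpt ε) := by
  rcases lt_or_ge ε epsStar with h | h
  · rw [betaOpt, if_pos h]
    exact ⟨by norm_num, isMinOn_worstVar_zero hε h⟩
  rw [betaOpt, if_neg (not_lt.2 h)]
  rcases lt_or_ge ε (Real.log 2) with h' | h'
  · obtain ⟨h1, h2, h3⟩ := conditions_of_lt_log_two hε h' h
    have := isMinOn_worstVar_of_root hε (a_mem_Icc ε).1 (a_mem_Icc ε).2 h1 h2 h3 rfl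
    have hβ : beta1 (Real.exp ε) (Real.exp (ε / 3)) (a ε) = (Real.exp ε - 1
        - √(coefB (Real.exp ε) (Real.exp (ε / 3)) (a ε)
          / coefA (Real.exp ε) (Real.exp (ε / 3)) (a ε)))
        / (Real.exp ε + Real.exp (ε / 3)) := by
      have ha : a ε = 0 := by rw [a, if_pos h']
      have := Real.exp_pos ε
      have := Real.exp_pos (ε / 3)
      -- At `ε = ε*` the coefficient `coefA` vanishes as well; the quotient is then `0 / 0 = 0`, the
      -- value needed.
      have hB : coefB (Real.exp ε) (Real.exp (ε / 3)) 0 = 0 := by simp [coefB]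
      rw [ha, hB, zero_div, Real.sqrt_zero, beta1]
      field_simp
      ring
    rw [if_pos h', hβ]
    exact this
  · obtain ⟨h1, h2, h3⟩ := conditions_of_log_two_le h'
    have := isMinOn_worstVar_of_root hε (a_mem_Icc ε).1 (a_mem_Icc ε).2 h1 h2 h3 rfl
    rw [if_neg (not_lt.2 h'), beta3, neg_add_eq_sub, sub_right_comm]
    exact this

end HMTP

theorem mainTheorem5 :
    |HMTP.epsStar - 0.610986| < 1 / 10 ^ 6 ∧
    ∀ ε : ℝ, 0 < ε →
      (∀ β ∈ Set.Icc (0 : ℝ) 1, ∀ x ∈ Set.Icc (-1 : ℝ) 1,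
        HMTP.hmVar ε β x =
          β * ProbabilityTheory.variance id (HMTP.pmSub ε x)
            + (1 - β) * ProbabilityTheory.variance id (HMTP.threeOutputs ε x)) ∧
      (∀ β ∈ Set.Icc (0 : ℝ) 1,
        IsGreatest (HMTP.hmVar ε β '' Set.Icc (-1) 1) (HMTP.worstVar ε β)) ∧
      HMTP.betaOpt ε ∈ Set.Icc (0 : ℝ) 1 ∧
      IsMinOn (HMTP.worstVar ε) (Set.Icc 0 1) (HMTP.betaOpt ε) := by
  refine ⟨HMTP.abs_epsStar_sub_lt, fun ε hε => ?_⟩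
  obtain ⟨h0, h1⟩ := HMTP.a_mem_Icc ε
  exact ⟨fun β hβ x hx => HMTP.hmVar_eq hε h0 h1 hβ hx,
    fun β hβ => HMTP.isGreatest_worstVar hε h0 h1 hβ, HMTP.betaOpt_spec hε⟩
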